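/- Let $1\le m<d$ and let $\emptyset\ne M\subseteq\mathbb R^d$, with the Euclidean norm $\|\cdot\|$; put $d(x,M)=\inf_{\xi\in M}\|x-\xi\|$ and, for $\varepsilon>0$, $M^\varepsilon=\{x: d(x,M)<\varepsilon\}$. Let $\operatorname{unpp}(M)$ be the set of all $x\in\mathbb R^d$ for which there is exactly one $\xi\in M$ with $\|x-\xi\|=d(x,M)$, let $\mathscr E(M)$ be its interior, and let $$\operatorname{reach}(M)=\sup\{\varepsilon\in(0,\infty): M^\varepsilon\subseteq\operatorname{unpp}(M)\}\in[0,\infty]\qquad(\sup\emptyset=0).$$ $M$ is an $m$-dimensional $C^k$ submanifold of $\mathbb R^d$ if every $\xi\in M$ lies in an open set $U\subseteq\mathbb R^d$ for which there are an open set $V\subseteq\mathbb R^d$ and a $C^k$ diffeomorphism $\Psi:V\to U$ such that, for all $y\in V$, $\Psi(y)\in M$ if and only if $y_{m+1}=\dots=y_d=0$. For $k\ge1$ let $T_\xi(M)$ denote its tangent space at $\xi$, that is, the set of all $\gamma'(0)$ for $C^1$ curves $\gamma:(-1,1)\to M$ with $\gamma(0)=\xi$. With $S$ the unit sphere of $\mathbb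 R^d$, put $d_H(T_1,T_2)=\sup_{t_1\in T_1\cap S}\inf_{t_2\in T_2\cap S}\|t_2-t_1\|$. $M$ is an $m$-dimensional $\operatorname{Lip}^1$ submanifold if it is an $m$-dimensional $C^1$ submanifold and $\xi\mapsto T_\xi(M)$ is locally Lipschitz with respect to $d_H$, i.e. every point of $M$ has an open neighborhood $V$ in $M$ and a constant $L>0$ such that $d_H(T_\zeta(M),T_\eta(M))\le L\|\zeta-\eta\|$ for all $\zeta,\eta\in V$. Finally let $\nu_1(M)=\{(\xi,v): \xi\in M,\ v\perp T_\xi(M),\ \|v\|=1\}$ and, for $(\xi,v)\in\nu_1(M)$, $$\vartheta(\xi,v)=\sup\{r>0: \{\xi+sv: 0<s<r\}\subseteq\mathscr E(M)\}.$$ Let $M$ be an $m$-dimensional $\operatorname{Lip}^1$ submanifold of $\mathbb R^d$. Then $$\operatorname{reach}(M)\le\inf\{\vartheta(\xi,v):(\xi,v)\in\nu_1(M)\},$$ with equality if $M$ is a closed subset of $\mathbb R^d$. If $M$ is compact, then the minimum below is attained and $$\operatorname{reach}(M)=\min\{\vartheta(\xi,v):(\xi,v)\in\nu_1(M)\}>0.$$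 Moreover, every nonempty compact $m$-dimensional $C^2$ submanifold $M$ of $\mathbb R^d$ satisfies $\operatorname{reach}(M)>0$. -/

import Mathlib

open Set Topology
open scoped ENNReal

/-- The points of `ℝ^d` that have exactly one nearest point on `M`. -/
def unpp {d : ℕ} (M : Set (EuclideanSpace ℝ (Fin d))) : Set (EuclideanSpace ℝ (Fin d)) :=
  {x | ∃! ξ, ξ ∈ M ∧ ‖x - ξ‖ = Metric.infDist x M}

/-- `𝓔(M)`: the largest open set of points with a unique nearest point on `M`. -/
def unppInterior {d : ℕ} (M : Set (EuclideanSpace ℝ (Fin d))) :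
    Set (EuclideanSpace ℝ (Fin d)) :=
  interior (unpp M)

/-- `M` is an `m`-dimensional `C^k` submanifold of `ℝ^d`: around every point of `M` there is a `C^k`
diffeomorphism between open subsets of `ℝ^d` (from `Ψ.source` onto `Ψ.target`) that flattens `M`
to the subspace on which all coordinates after the first `m` vanish. -/
def IsCkSubmanifold {d : ℕ} (k m : ℕ) (M : Set (EuclideanSpace ℝ (Fin d))) : Prop :=
  ∀ ξ ∈ M, ∃ Ψ : OpenPartialHomeomorph (EuclideanSpace ℝ (Fin d)) (EuclideanSpace ℝ (Fin d)),
    ContDiffOn ℝ k Ψ Ψ.source ∧ ContDiffOn ℝ k Ψ.symm Ψ.target ∧ ξ ∈ Ψ.target ∧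
      ∀ y ∈ Ψ.source, (Ψ y ∈ M ↔ ∀ i : Fin d, m ≤ (i : ℕ) → y i = 0)

/-- The tangent space `T_ξ(M)`: velocities at time `0` of `C^1` curves `(-1, 1) → M` that are
at `ξ` at time `0`. -/
def tangentSet {d : ℕ} (M : Set (EuclideanSpace ℝ (Fin d))) (ξ : EuclideanSpace ℝ (Fin d)) :
    Set (EuclideanSpace ℝ (Fin d)) :=
  {t | ∃ γ : ℝ → EuclideanSpace ℝ (Fin d), ContDiffOn ℝ 1 γ (Ioo (-1) 1) ∧
    (∀ s ∈ Ioo (-1 : ℝ) 1, γ s ∈ M) ∧ γ 0 = ξ ∧ HasDerivAt γ t 0}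

/-- The distance `sup_{t₁ ∈ T₁ ∩ S} inf_{t₂ ∈ T₂ ∩ S} ‖t₂ - t₁‖`, where `S` is the unit sphere. -/
noncomputable def sphereHausdorffDist {d : ℕ} (T₁ T₂ : Set (EuclideanSpace ℝ (Fin d))) : ℝ≥0∞ :=
  ⨆ t₁ ∈ T₁ ∩ Metric.sphere 0 1, ⨅ t₂ ∈ T₂ ∩ Metric.sphere 0 1, ENNReal.ofReal ‖t₂ - t₁‖

/-- `M` is an `m`-dimensional `Lip^1` submanifold: a `C^1` submanifold whose tangent spaces depend
locally Lipschitz continuously on the base point. -/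
def IsLipOneSubmanifold {d : ℕ} (m : ℕ) (M : Set (EuclideanSpace ℝ (Fin d))) : Prop :=
  IsCkSubmanifold 1 m M ∧
    ∀ ξ ∈ M, ∃ U : Set (EuclideanSpace ℝ (Fin d)), IsOpen U ∧ ξ ∈ U ∧ ∃ L : ℝ, 0 < L ∧
      ∀ ζ ∈ M ∩ U, ∀ η ∈ M ∩ U,
        sphereHausdorffDist (tangentSet M ζ) (tangentSet M η) ≤ ENNReal.ofReal (L * ‖ζ - η‖)

/-- The unit normal bundle `ν₁(M)`. -/
def unitNormalBundle {d : ℕ} (M : Set (EuclideanSpace ℝ (Fin d))) :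
    Set (EuclideanSpace ℝ (Fin d) × EuclideanSpace ℝ (Fin d)) :=
  {q | q.1 ∈ M ∧ (∀ t ∈ tangentSet M q.1, inner ℝ q.2 t = 0) ∧ ‖q.2‖ = 1}

/-- The frontier function `ϑ(ξ, v) = sup {r > 0 : ]ξ, ξ + r v[ ⊆ 𝓔(M)}` (used on `ν₁(M)`). -/
noncomputable def frontierFunction {d : ℕ} (M : Set (EuclideanSpace ℝ (Fin d)))
    (q : EuclideanSpace ℝ (Fin d) × EuclideanSpace ℝ (Fin d)) : ℝ≥0∞ :=
  sSup {a | ∃ r : ℝ, 0 < r ∧ openSegment ℝ q.1 (q.1 + r • q.2) ⊆ unppInterior M ∧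
    a = ENNReal.ofReal r}

/-- `reach(M) = sup {ε > 0 : M^ε ⊆ unpp(M)}` in `[0, ∞]`, where `M^ε` is the open
`ε`-neighborhood of `M` and the supremum of the empty set is `0`. -/
noncomputable def reach {d : ℕ} (M : Set (EuclideanSpace ℝ (Fin d))) : ℝ≥0∞ :=
  sSup {a | ∃ ε : ℝ, 0 < ε ∧ Metric.thickening ε M ⊆ unpp M ∧ a = ENNReal.ofReal ε}

/-! If `ξ` is nearest to `x`, the first-order condition along curves in `M` makes `x - ξ` normal. So
for closed `M` each point off `M` lies on a normal ray, at parameter `d(x, M)`, and bounds on the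
frontier function become bounds on the reach. This comparison needs no smoothness.

Positivity is where regularity enters, through `HasLocalQuadraticNormalBound`. If `ξ`, `η` are
equidistant from `x` and `x - ξ` is normal at `ξ`, then `‖η - ξ‖² = 2⟪x - ξ, η - ξ⟫ ≤ 2C‖x - ξ‖‖η -
ξ‖²`, so `η = ξ` once `2C‖x - ξ‖ < 1`; compactness makes the radius uniform. Both `C²` and `Lip¹`
submanifolds satisfy the bound, by a mean value argument in a chart. -/

theorem tangentSet_orthogonal_of_nearest {d : ℕ} {M : Set (EuclideanSpace ℝ (Fin d))}
    {x ξ : EuclideanSpace ℝ (Fin d)} (hmin : ∀ η ∈ M, ‖x - ξ‖ ≤ ‖x - η‖) :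
    ∀ t ∈ tangentSet M ξ, inner ℝ (x - ξ) t = 0 := by
  rintro t ⟨γ, -, hγM, hγ0, hγ⟩
  have h1 : HasDerivAt (fun s => ‖x - γ s‖ ^ 2) (2 * inner ℝ (x - γ 0) (-t)) 0 :=
    (hγ.const_sub x).norm_sq
  have h2 : IsLocalMin (fun s => ‖x - γ s‖ ^ 2) 0 := by
    filter_upwards [Ioo_mem_nhds (show (-1 : ℝ) < 0 by norm_num) one_pos] with s hs
    rw [hγ0]
    exact pow_le_pow_left₀ (norm_nonneg _) (hmin _ (hγM s hs)) 2
  have h3 := h2.hasDerivAt_eq_zero h1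
  rw [hγ0, inner_neg_right] at h3
  linarith

theorem norm_sub_le_of_eq_infDist {d : ℕ} {M : Set (EuclideanSpace ℝ (Fin d))}
    {x ξ : EuclideanSpace ℝ (Fin d)} (h : ‖x - ξ‖ = Metric.infDist x M) :
    ∀ η ∈ M, ‖x - ξ‖ ≤ ‖x - η‖ := fun η hη => by
  rw [h, ← dist_eq_norm]; exact Metric.infDist_le_dist_of_mem hη

theorem subset_unpp {d : ℕ} (M : Set (EuclideanSpace ℝ (Fin d))) : M ⊆ unpp M := by
  intro x hx
  refine ⟨x, ⟨hx, by simp [Metric.infDist_zero_of_mem hx]⟩, ?_⟩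
  rintro η ⟨-, h⟩
  rw [Metric.infDist_zero_of_mem hx, norm_eq_zero, sub_eq_zero] at h
  exact h.symm

/-! ### Reach versus frontier function -/

theorem thickening_subset_unppInterior_of_lt_reach {d : ℕ}
    {M : Set (EuclideanSpace ℝ (Fin d))} {ε : ℝ} (h : ENNReal.ofReal ε < reach M) :
    Metric.thickening ε M ⊆ unppInterior M := by
  obtain ⟨a, ⟨ε', hε', hsub, rfl⟩, hlt⟩ := lt_sSup_iff.1 h
  refine (Metric.thickening_mono ((ENNReal.ofReal_lt_ofReal_iff hε').1 hlt).le M).trans ?_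
  exact interior_maximal hsub Metric.isOpen_thickening

theorem reach_le_frontierFunction {d : ℕ} {M : Set (EuclideanSpace ℝ (Fin d))}
    {q : EuclideanSpace ℝ (Fin d) × EuclideanSpace ℝ (Fin d)} (hq : q ∈ unitNormalBundle M) :
    reach M ≤ frontierFunction M q := by
  refine sSup_le ?_
  rintro a ⟨ε, hε, hsub, rfl⟩
  refine le_sSup ⟨ε, hε, ?_, rfl⟩
  refine Subset.trans ?_ (interior_maximal hsub Metric.isOpen_thickening)
  rw [openSegment_eq_image']
  rintro _ ⟨s, hs, rfl⟩
  refine Metric.mem_thickening_iff.2 ⟨q.1, hq.1, ?_⟩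
  simp only [add_sub_cancel_left, dist_self_add_left, norm_smul, hq.2.2, Real.norm_eq_abs,
    abs_of_pos hs.1, abs_of_pos hε]
  nlinarith [hs.2]

theorem mem_unppInterior_of_lt_frontierFunction {d : ℕ} {M : Set (EuclideanSpace ℝ (Fin d))}
    {q : EuclideanSpace ℝ (Fin d) × EuclideanSpace ℝ (Fin d)} {s : ℝ} (hs : 0 < s)
    (h : ENNReal.ofReal s < frontierFunction M q) : q.1 + s • q.2 ∈ unppInterior M := by
  obtain ⟨a, ⟨r, hr, hsub, rfl⟩, hlt⟩ := lt_sSup_iff.1 h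
  have hsr := (ENNReal.ofReal_lt_ofReal_iff hr).1 hlt
  apply hsub
  rw [openSegment_eq_image']
  refine ⟨s / r, ⟨by positivity, (div_lt_one hr).2 hsr⟩, ?_⟩
  simp [smul_smul, div_mul_cancel₀ s hr.ne']

theorem exists_unitNormalBundle_of_notMem {d : ℕ} {M : Set (EuclideanSpace ℝ (Fin d))}
    (hMc : IsClosed M) (hM : M.Nonempty) {x : EuclideanSpace ℝ (Fin d)} (hx : x ∉ M) :
    ∃ q ∈ unitNormalBundle M, x = q.1 + Metric.infDist x M • q.2 ∧ 0 < Metric.infDist x M := by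
  obtain ⟨ξ, hξ, hd⟩ := hMc.exists_infDist_eq_dist hM x
  have hpos : 0 < Metric.infDist x M := (hMc.notMem_iff_infDist_pos hM).1 hx
  rw [dist_eq_norm] at hd
  refine ⟨(ξ, (Metric.infDist x M)⁻¹ • (x - ξ)), ⟨hξ, ?_, ?_⟩, ?_, hpos⟩
  · intro t ht
    have := tangentSet_orthogonal_of_nearest (norm_sub_le_of_eq_infDist hd.symm) t ht
    simp only [inner_smul_left, this, mul_zero]
  · rw [norm_smul, norm_inv, Real.norm_of_nonneg hpos.le, ← hd, inv_mul_cancel₀ hpos.ne']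
  · simp [smul_smul, mul_inv_cancel₀ hpos.ne']

theorem sInf_frontierFunction_le_reach {d : ℕ} {M : Set (EuclideanSpace ℝ (Fin d))}
    (hM : M.Nonempty) (hMc : IsClosed M) :
    sInf (frontierFunction M '' unitNormalBundle M) ≤ reach M := by
  refine ENNReal.le_of_forall_pos_nnreal_lt fun r hr hlt => ?_
  refine le_sSup ⟨r, hr, ?_, by simp⟩
  intro x hx
  by_cases hxM : x ∈ M
  · exact subset_unpp M hxM
  obtain ⟨q, hq, hxq, hpos⟩ := exists_unitNormalBundle_of_notMem hMc hM hxM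
  rw [hxq]
  refine interior_subset (mem_unppInterior_of_lt_frontierFunction hpos ?_)
  refine lt_of_lt_of_le ?_ (sInf_le (mem_image_of_mem _ hq))
  refine lt_trans ?_ hlt
  rw [← ENNReal.ofReal_coe_nnreal]
  refine (ENNReal.ofReal_lt_ofReal_iff (by exact_mod_cast hr)).2 ?_
  exact (Metric.mem_thickening_iff_infDist_lt hM).1 hx

/-- If every value exceeded the reach `R`, the whole closed `R`-neighborhood would lie in the open
set `unppInterior M`; being compact, it would have room to grow, contradicting the maximality of
`R`. -/
theorem reach_mem_image_frontierFunction {d : ℕ} (hd : 0 < d)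
    {M : Set (EuclideanSpace ℝ (Fin d))} (hM : M.Nonempty) (hMc : IsCompact M)
    (hpos : 0 < reach M) : reach M ∈ frontierFunction M '' unitNormalBundle M := by
  have hle : ∀ q ∈ unitNormalBundle M, reach M ≤ frontierFunction M q :=
    fun q hq => reach_le_frontierFunction hq
  by_contra hcon
  have hlt : ∀ q ∈ unitNormalBundle M, reach M < frontierFunction M q := fun q hq =>
    (hle q hq).lt_of_ne fun h => hcon ⟨q, hq, h.symm⟩
  -- The ambient space is then noncompact, so some point lies off `M`; this gives a unit normal and
  -- hence a finite reach.
  have : Nonempty (Fin d) := ⟨⟨0, hd⟩⟩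
  obtain ⟨x, hx⟩ : ∃ x, x ∉ M := by
    by_contra! h
    exact noncompact_univ (EuclideanSpace ℝ (Fin d)) (eq_univ_of_forall h ▸ hMc)
  obtain ⟨q, hq, -⟩ := exists_unitNormalBundle_of_notMem hMc.isClosed hM hx
  have htop : reach M ≠ ⊤ := (lt_top_of_lt (hlt q hq)).ne
  set R := (reach M).toReal with hR
  have hRof : ENNReal.ofReal R = reach M := ENNReal.ofReal_toReal htop
  have hR0 : 0 < R := ENNReal.toReal_pos hpos.ne' htop
  have hsub : Metric.cthickening R M ⊆ unppInterior M := by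
    intro y hy
    by_cases hyM : y ∈ M
    · have hhalf : ENNReal.ofReal (R / 2) < reach M := by
        rw [← hRof]; exact (ENNReal.ofReal_lt_ofReal_iff hR0).2 (by linarith)
      exact thickening_subset_unppInterior_of_lt_reach hhalf
        (Metric.self_subset_thickening (by positivity) M hyM)
    · obtain ⟨q, hq, hyq, hypos⟩ := exists_unitNormalBundle_of_notMem hMc.isClosed hM hyM
      rw [hyq]
      refine mem_unppInterior_of_lt_frontierFunction hypos (lt_of_le_of_lt ?_ (hlt q hq))
      rw [← hRof]
      refine ENNReal.ofReal_le_ofReal ?_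
      exact ENNReal.toReal_le_of_le_ofReal hR0.le (Metric.mem_cthickening_iff.1 hy)
  obtain ⟨δ, hδ, hδsub⟩ := hMc.cthickening.exists_thickening_subset_open isOpen_interior hsub
  have : ENNReal.ofReal (R + δ) ≤ reach M := by
    refine le_sSup ⟨R + δ, by positivity, ?_, rfl⟩
    rw [add_comm, ← thickening_cthickening hδ hR0.le M]
    exact hδsub.trans interior_subset
  rw [← hRof, ENNReal.ofReal_le_ofReal_iff hR0.le] at this
  linarith

/-! ### Tangent vectors from charts -/

theorem hasDerivAt_comp_add_smul {E F : Type*} [NormedAddCommGroup E] [NormedSpace ℝ E]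
    [NormedAddCommGroup F] [NormedSpace ℝ F] {f : E → F} {φ : ℝ → ℝ} {φ' s : ℝ} (a w : E)
    (hφ : HasDerivAt φ φ' s) (hf : DifferentiableAt ℝ f (a + φ s • w)) :
    HasDerivAt (fun u => f (a + φ u • w)) (φ' • fderiv ℝ f (a + φ s • w) w) s := by
  have h1 : HasDerivAt (fun u => a + φ u • w) (φ' • w) s := (hφ.smul_const w).const_add a
  rw [← map_smul]
  exact hf.hasFDerivAt.comp_hasDerivAt s h1

theorem fderiv_mem_tangentSet {d m : ℕ} {M : Set (EuclideanSpace ℝ (Fin d))}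
    {f : EuclideanSpace ℝ (Fin d) → EuclideanSpace ℝ (Fin d)}
    {s : Set (EuclideanSpace ℝ (Fin d))} (hs : IsOpen s) (hf : ContDiffOn ℝ 1 f s)
    (hfM : ∀ y ∈ s, (∀ i : Fin d, m ≤ (i : ℕ) → y i = 0) → f y ∈ M)
    {c w : EuclideanSpace ℝ (Fin d)} (hc : c ∈ s) (hc0 : ∀ i : Fin d, m ≤ (i : ℕ) → c i = 0)
    (hw0 : ∀ i : Fin d, m ≤ (i : ℕ) → w i = 0) : fderiv ℝ f c w ∈ tangentSet M (f c) := by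
  obtain ⟨r, hr, hball⟩ := Metric.isOpen_iff.1 hs c hc
  -- The parameter `δ sin(u/δ)` has speed `1` at `0` but never exceeds `δ` in size, so the curve
  -- stays in the ball for all `u` without rescaling `w`.
  set δ := r / (‖w‖ + 1) with hδdef
  have hδ : 0 < δ := by positivity
  have hmem : ∀ u : ℝ, c + (δ * Real.sin (u / δ)) • w ∈ s := fun u => by
    apply hball
    rw [mem_ball_iff_norm, add_sub_cancel_left, norm_smul, norm_mul, Real.norm_of_nonneg hδ.le]
    have h1 : ‖Real.sin (u / δ)‖ ≤ 1 := Real.abs_sin_le_one _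
    calc δ * ‖Real.sin (u / δ)‖ * ‖w‖ ≤ δ * 1 * ‖w‖ := by gcongr
      _ < δ * (‖w‖ + 1) := by nlinarith
      _ = r := by rw [hδdef]; field_simp
  refine ⟨fun u => f (c + (δ * Real.sin (u / δ)) • w), ?_, fun u _ => ?_, by simp, ?_⟩
  · refine hf.comp (ContDiff.contDiffOn ?_) fun u _ => hmem u
    have : ContDiff ℝ 1 fun u : ℝ => Real.sin (u / δ) :=
      Real.contDiff_sin.comp (contDiff_id.div_const δ)
    fun_prop
  · refine hfM _ (hmem u) fun i hi => ?_
    simp [hc0 i hi, hw0 i hi]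
  · have hφ : HasDerivAt (fun u => δ * Real.sin (u / δ)) 1 0 := by
      have := (((hasDerivAt_id (0 : ℝ)).div_const δ).sin).const_mul δ
      simpa [hδ.ne'] using this
    have hd : DifferentiableAt ℝ f (c + (δ * Real.sin (0 / δ)) • w) :=
      (hf.differentiableOn one_ne_zero).differentiableAt (hs.mem_nhds (hmem 0))
    simpa using hasDerivAt_comp_add_smul c w hφ hd

/-! ### Positive reach from the quadratic normal bound -/

/-- Secants of `M` near each of its points make an angle with the tangent space that is
of the order of their length. -/
def HasLocalQuadraticNormalBound {d : ℕ} (M : Set (EuclideanSpace ℝ (Fin d))) : Prop :=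
  ∀ p ∈ M, ∃ U ∈ 𝓝 p, ∃ C : ℝ, ∀ ξ ∈ M ∩ U, ∀ η ∈ M ∩ U, ∀ n : EuclideanSpace ℝ (Fin d),
    (∀ t ∈ tangentSet M ξ, inner ℝ n t = 0) → inner ℝ n (η - ξ) ≤ C * ‖n‖ * ‖η - ξ‖ ^ 2

theorem HasLocalQuadraticNormalBound.reach_pos {d : ℕ} {M : Set (EuclideanSpace ℝ (Fin d))}
    (h : HasLocalQuadraticNormalBound M) (hM : M.Nonempty) (hMc : IsCompact M) :
    0 < reach M := by
  have key : ∃ ε : ℝ, 0 < ε ∧ ∀ ξ ∈ M, ∀ η ∈ M, ∀ x, ‖x - ξ‖ < ε → ‖x - η‖ = ‖x - ξ‖ →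
      (∀ t ∈ tangentSet M ξ, inner ℝ (x - ξ) t = 0) → η = ξ := by
    refine hMc.induction_on (p := fun s => ∃ ε : ℝ, 0 < ε ∧ ∀ ξ ∈ s, ∀ η ∈ M, ∀ x,
      ‖x - ξ‖ < ε → ‖x - η‖ = ‖x - ξ‖ →
      (∀ t ∈ tangentSet M ξ, inner ℝ (x - ξ) t = 0) → η = ξ) ⟨1, one_pos, by simp⟩ ?_ ?_ ?_
    · rintro s t hst ⟨ε, hε, H⟩
      exact ⟨ε, hε, fun ξ hξ => H ξ (hst hξ)⟩
    · rintro s t ⟨ε₁, hε₁, H₁⟩ ⟨ε₂, hε₂, H₂⟩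
      refine ⟨min ε₁ ε₂, lt_min hε₁ hε₂, ?_⟩
      rintro ξ (hξ | hξ) η hη x hx
      · exact H₁ ξ hξ η hη x (hx.trans_le (min_le_left _ _))
      · exact H₂ ξ hξ η hη x (hx.trans_le (min_le_right _ _))
    · intro p hp
      obtain ⟨U, hU, C, hC⟩ := h p hp
      obtain ⟨δ, hδ, hball⟩ := Metric.mem_nhds_iff.1 hU
      refine ⟨Metric.ball p (δ / 2) ∩ M, Filter.inter_mem
        (mem_nhdsWithin_of_mem_nhds (Metric.ball_mem_nhds p (by positivity)))
        -- `δ / 4` forces `‖η - ξ‖ < δ / 2`, so `η ∈ U`; the other term gives `C‖x - ξ‖ < 1 / 2`.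
        self_mem_nhdsWithin, min (δ / 4) (1 / (2 * (|C| + 1))), by positivity, ?_⟩
      rintro ξ ⟨hξp, hξM⟩ η hηM x hx hxη hn
      have hx1 := hx.trans_le (min_le_left _ _)
      have hx2 := hx.trans_le (min_le_right _ _)
      have hξη : ‖η - ξ‖ < δ / 2 := by
        have : ‖η - ξ‖ ≤ ‖x - ξ‖ + ‖x - η‖ := by
          rw [show η - ξ = (x - ξ) - (x - η) by abel]; exact norm_sub_le _ _
        linarith
      have hξU : ξ ∈ U := hball (Metric.ball_subset_ball (by linarith) hξp)
      have hηU : η ∈ U := hball <| by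
        rw [Metric.mem_ball] at hξp ⊢
        rw [← dist_eq_norm] at hξη
        linarith [dist_triangle η ξ p]
      have hb := hC ξ ⟨hξM, hξU⟩ η ⟨hηM, hηU⟩ (x - ξ) hn
      have hexp : ‖x - η‖ ^ 2 = ‖x - ξ‖ ^ 2 - 2 * inner ℝ (x - ξ) (η - ξ) + ‖η - ξ‖ ^ 2 := by
        rw [← norm_sub_sq_real, sub_sub_sub_cancel_right]
      rw [hxη] at hexp
      have hsmall : C * ‖x - ξ‖ < 1 / 2 := by
        have h1 : ‖x - ξ‖ * (2 * (|C| + 1)) < 1 := (lt_div_iff₀ (by positivity)).1 hx2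
        have h2 : C * ‖x - ξ‖ ≤ |C| * ‖x - ξ‖ := by gcongr; exact le_abs_self C
        nlinarith [norm_nonneg (x - ξ)]
      by_contra hne
      have : 0 < ‖η - ξ‖ ^ 2 := by
        have := norm_pos_iff.2 (sub_ne_zero.2 hne)
        positivity
      nlinarith
  obtain ⟨ε, hε, H⟩ := key
  refine lt_of_lt_of_le (ENNReal.ofReal_pos.2 hε) (le_sSup ⟨ε, hε, ?_, rfl⟩)
  intro x hx
  obtain ⟨ξ, hξ, hd⟩ := hMc.exists_infDist_eq_dist hM x
  rw [dist_eq_norm] at hd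
  refine ⟨ξ, ⟨hξ, hd.symm⟩, ?_⟩
  rintro η ⟨hη, hdη⟩
  refine H ξ hξ η hη x ?_ (hdη.trans hd)
    (tangentSet_orthogonal_of_nearest (norm_sub_le_of_eq_infDist hd.symm))
  rw [← hd]
  exact (Metric.mem_thickening_iff_infDist_lt hM).1 hx

/-! ### The quadratic normal bound for `C²` and `Lip¹` submanifolds -/

theorem inner_sub_le_of_fderiv_le {E F : Type*} [NormedAddCommGroup E] [NormedSpace ℝ E]
    [NormedAddCommGroup F] [InnerProductSpace ℝ F] {f : E → F} {a b : E} {n : F} {B : ℝ}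
    (hf : ∀ s ∈ Icc (0 : ℝ) 1, DifferentiableAt ℝ f (a + s • (b - a)))
    (hB : ∀ s ∈ Icc (0 : ℝ) 1, inner ℝ n (fderiv ℝ f (a + s • (b - a)) (b - a)) ≤ B) :
    inner ℝ n (f b - f a) ≤ B := by
  have hder : ∀ s ∈ Icc (0 : ℝ) 1, HasDerivAt (fun u : ℝ => inner ℝ n (f (a + u • (b - a))))
      (inner ℝ n (fderiv ℝ f (a + s • (b - a)) (b - a))) s := fun s hs => by
    have h1 := hasDerivAt_comp_add_smul a (b - a) (hasDerivAt_id s) (hf s hs)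
    rw [one_smul] at h1
    exact (innerSL ℝ n).hasFDerivAt.comp_hasDerivAt s h1
  have hmv := (convex_Icc (0 : ℝ) 1).image_sub_le_mul_sub_of_deriv_le
    (f := fun u : ℝ => inner ℝ n (f (a + u • (b - a)))) (C := B)
    (fun s hs => (hder s hs).continuousAt.continuousWithinAt)
    (fun s hs => (hder s (interior_subset hs)).differentiableAt.differentiableWithinAt)
    (fun s hs => by rw [(hder s (interior_subset hs)).deriv]; exact hB s (interior_subset hs))
    0 (by simp) 1 (by simp) zero_le_one
  rw [inner_sub_right]
  simpa using hmv

/-- Integrating a first-order tilt of the tangent vectors along the flat chart segment gives a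
second-order bound; the local Lipschitz property of `Ψ.symm` converts chart lengths back to lengths
in `M`. -/
theorem hasLocalQuadraticNormalBound_of_charts {d m : ℕ} {M : Set (EuclideanSpace ℝ (Fin d))}
    (h : ∀ p ∈ M, ∃ Ψ : OpenPartialHomeomorph (EuclideanSpace ℝ (Fin d))
        (EuclideanSpace ℝ (Fin d)),
      ContDiffOn ℝ 1 Ψ Ψ.source ∧ ContDiffOn ℝ 1 Ψ.symm Ψ.target ∧ p ∈ Ψ.target ∧
      (∀ y ∈ Ψ.source, (Ψ y ∈ M ↔ ∀ i : Fin d, m ≤ (i : ℕ) → y i = 0)) ∧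
      ∃ V ∈ 𝓝 (Ψ.symm p), ∃ C : ℝ, ∀ a ∈ V, ∀ c ∈ V, ∀ w n : EuclideanSpace ℝ (Fin d),
        (∀ i : Fin d, m ≤ (i : ℕ) → a i = 0) → (∀ i : Fin d, m ≤ (i : ℕ) → c i = 0) →
        (∀ i : Fin d, m ≤ (i : ℕ) → w i = 0) → (∀ t ∈ tangentSet M (Ψ a), inner ℝ n t = 0) →
        inner ℝ n (fderiv ℝ Ψ c w) ≤ C * ‖n‖ * ‖c - a‖ * ‖w‖) :
    HasLocalQuadraticNormalBound M := by
  intro p hp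
  obtain ⟨Ψ, hΨ, hΨs, hpt, hflat, V, hV, C, hC⟩ := h p hp
  have hq := Ψ.map_target hpt
  obtain ⟨r, hr, hball⟩ := Metric.mem_nhds_iff.1
    (Filter.inter_mem hV (Ψ.open_source.mem_nhds hq))
  obtain ⟨K, W, hW, hK⟩ :=
    (hΨs.contDiffAt (Ψ.open_target.mem_nhds hpt)).exists_lipschitzOnWith
  have hcont : ContinuousAt Ψ.symm p := Ψ.symm.continuousAt hpt
  refine ⟨(W ∩ Ψ.target) ∩ Ψ.symm ⁻¹' Metric.ball (Ψ.symm p) r,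
    Filter.inter_mem (Filter.inter_mem hW (Ψ.open_target.mem_nhds hpt))
      (hcont (Metric.ball_mem_nhds _ hr)), |C| * K ^ 2, ?_⟩
  rintro ξ ⟨hξM, ⟨hξW, hξt⟩, hξb⟩ η ⟨hηM, ⟨hηW, hηt⟩, hηb⟩ n hn
  obtain ⟨a, ha⟩ : ∃ a, a = Ψ.symm ξ := ⟨_, rfl⟩
  obtain ⟨b, hb⟩ : ∃ b, b = Ψ.symm η := ⟨_, rfl⟩
  rw [mem_preimage, ← ha] at hξb
  rw [mem_preimage, ← hb] at hηb
  have hΨa : Ψ a = ξ := ha ▸ Ψ.right_inv hξt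
  have hΨb : Ψ b = η := hb ▸ Ψ.right_inv hηt
  have ha0 := (hflat a (ha ▸ Ψ.map_target hξt)).1 (hΨa ▸ hξM)
  have hb0 := (hflat b (hb ▸ Ψ.map_target hηt)).1 (hΨb ▸ hηM)
  have hseg : ∀ s ∈ Icc (0 : ℝ) 1, a + s • (b - a) ∈ Metric.ball (Ψ.symm p) r := fun s hs =>
    (convex_ball _ _).add_smul_sub_mem hξb hηb hs
  have hw0 : ∀ i : Fin d, m ≤ (i : ℕ) → (b - a) i = 0 := fun i hi => by
    simp [ha0 i hi, hb0 i hi]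
  set B := |C| * ‖n‖ * ‖b - a‖ ^ 2 with hB
  have hbound : ∀ s ∈ Icc (0 : ℝ) 1,
      inner ℝ n (fderiv ℝ Ψ (a + s • (b - a)) (b - a)) ≤ B := fun s hs => by
    refine (hC a (hball hξb).1 _ (hball (hseg s hs)).1 (b - a) n ha0 (fun i hi => ?_) hw0
      (hΨa.symm ▸ hn)).trans ?_
    · have := hw0 i hi
      simp only [PiLp.add_apply, PiLp.smul_apply, this, ha0 i hi, smul_zero, add_zero]
    · rw [add_sub_cancel_left, norm_smul, Real.norm_of_nonneg hs.1]
      calc C * ‖n‖ * (s * ‖b - a‖) * ‖b - a‖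
          ≤ |C| * ‖n‖ * (1 * ‖b - a‖) * ‖b - a‖ := by
            have := hs.1
            gcongr
            · exact le_abs_self C
            · exact hs.2
        _ = B := by rw [hB]; ring
  have hmv : inner ℝ n (η - ξ) ≤ B := by
    rw [← hΨa, ← hΨb]
    exact inner_sub_le_of_fderiv_le (fun s hs => (hΨ.differentiableOn one_ne_zero).differentiableAt
      (Ψ.open_source.mem_nhds (hball (hseg s hs)).2)) hbound
  have hba : ‖b - a‖ ≤ K * ‖η - ξ‖ := by
    simpa [dist_eq_norm, ha, hb] using hK.dist_le_mul η hηW ξ hξW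
  calc inner ℝ n (η - ξ) ≤ |C| * ‖n‖ * ‖b - a‖ ^ 2 := hmv
    _ ≤ |C| * ‖n‖ * (K * ‖η - ξ‖) ^ 2 := by gcongr
    _ = |C| * K ^ 2 * ‖n‖ * ‖η - ξ‖ ^ 2 := by ring

theorem IsCkSubmanifold.hasLocalQuadraticNormalBound {d m : ℕ}
    {M : Set (EuclideanSpace ℝ (Fin d))} (h : IsCkSubmanifold 2 m M) :
    HasLocalQuadraticNormalBound M := by
  refine hasLocalQuadraticNormalBound_of_charts (m := m) fun p hp => ?_
  obtain ⟨Ψ, hΨ, hΨs, hpt, hflat⟩ := h p hp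
  have hq := Ψ.map_target hpt
  have hΨ1 : ContDiffOn ℝ 1 Ψ Ψ.source := hΨ.of_le (by norm_num)
  refine ⟨Ψ, hΨ1, hΨs.of_le (by norm_num), hpt, hflat, ?_⟩
  have hd : ContDiffAt ℝ 1 (fderiv ℝ Ψ) (Ψ.symm p) :=
    (hΨ.contDiffAt (Ψ.open_source.mem_nhds hq)).fderiv_right (by norm_num)
  obtain ⟨K, W, hW, hK⟩ := hd.exists_lipschitzOnWith
  refine ⟨W ∩ Ψ.source, Filter.inter_mem hW (Ψ.open_source.mem_nhds hq), K, ?_⟩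
  rintro a ⟨haW, has⟩ c ⟨hcW, hcs⟩ w n ha0 hc0 hw0 hn
  have hta := hn _ (fderiv_mem_tangentSet Ψ.open_source hΨ1
    (fun y hy h0 => (hflat y hy).2 h0) has ha0 hw0)
  have hLip : ‖fderiv ℝ Ψ c - fderiv ℝ Ψ a‖ ≤ K * ‖c - a‖ := by
    simpa [dist_eq_norm] using hK.dist_le_mul c hcW a haW
  -- The normal `n` kills the derivative at `a`, so only its variation counts.
  calc inner ℝ n (fderiv ℝ Ψ c w) = inner ℝ n ((fderiv ℝ Ψ c - fderiv ℝ Ψ a) w) := by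
        rw [sub_apply, inner_sub_right, hta, sub_zero]
    _ ≤ ‖n‖ * ‖(fderiv ℝ Ψ c - fderiv ℝ Ψ a) w‖ := real_inner_le_norm _ _
    _ ≤ ‖n‖ * (K * ‖c - a‖ * ‖w‖) := by
        gcongr; exact ContinuousLinearMap.le_of_opNorm_le _ hLip w
    _ = K * ‖n‖ * ‖c - a‖ * ‖w‖ := by ring

theorem inner_le_of_sphereHausdorffDist_le {d : ℕ} {T₁ T₂ : Set (EuclideanSpace ℝ (Fin d))}
    {r : ℝ} (hr : 0 ≤ r) (h : sphereHausdorffDist T₁ T₂ ≤ ENNReal.ofReal r)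
    {n t : EuclideanSpace ℝ (Fin d)} (ht : t ∈ T₁ ∩ Metric.sphere 0 1)
    (hn : ∀ s ∈ T₂, inner ℝ n s = 0) : inner ℝ n t ≤ ‖n‖ * r := by
  have hinf : ⨅ t₂ ∈ T₂ ∩ Metric.sphere 0 1, ENNReal.ofReal ‖t₂ - t‖ ≤ ENNReal.ofReal r :=
    (le_iSup₂ (f := fun t₁ (_ : t₁ ∈ T₁ ∩ Metric.sphere 0 1) =>
      ⨅ t₂ ∈ T₂ ∩ Metric.sphere 0 1, ENNReal.ofReal ‖t₂ - t₁‖) t ht).trans h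
  -- The infimum need not be attained, hence the slack `r' > r`, removed by a limit.
  have key : ∀ r' > r, inner ℝ n t ≤ ‖n‖ * r' := fun r' hr' => by
    have hlt := hinf.trans_lt ((ENNReal.ofReal_lt_ofReal_iff (hr.trans_lt hr')).2 hr')
    obtain ⟨t₂, ht₂, hlt⟩ := by simpa only [iInf_lt_iff] using hlt
    have hlt' := (ENNReal.ofReal_lt_ofReal_iff (hr.trans_lt hr')).1 hlt
    calc inner ℝ n t = inner ℝ n (t - t₂) := by rw [inner_sub_right, hn t₂ ht₂.1, sub_zero]
      _ ≤ ‖n‖ * ‖t - t₂‖ := real_inner_le_norm _ _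
      _ ≤ ‖n‖ * r' := by rw [norm_sub_rev]; gcongr
  have hlim : Filter.Tendsto (fun r' => ‖n‖ * r') (𝓝[>] r) (𝓝 (‖n‖ * r)) :=
    (tendsto_const_nhds.mul Filter.tendsto_id).mono_left nhdsWithin_le_nhds
  exact ge_of_tendsto hlim (eventually_mem_nhdsWithin.mono key)

/-- `fderiv ℝ Ψ` need not be Lipschitz here, so the tilt is read off the tangent spaces: the
normalized image of `w` is a unit tangent at `Ψ c`, close to unit tangents at `Ψ a`. -/
theorem IsLipOneSubmanifold.hasLocalQuadraticNormalBound {d m : ℕ}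
    {M : Set (EuclideanSpace ℝ (Fin d))} (h : IsLipOneSubmanifold m M) :
    HasLocalQuadraticNormalBound M := by
  refine hasLocalQuadraticNormalBound_of_charts (m := m) fun p hp => ?_
  obtain ⟨Ψ, hΨ, hΨs, hpt, hflat⟩ := h.1 p hp
  obtain ⟨U, hU, hpU, L, hL, hLip⟩ := h.2 p hp
  have hΨ1 : ContDiffOn ℝ 1 Ψ Ψ.source := hΨ
  have hq := Ψ.map_target hpt
  refine ⟨Ψ, hΨ1, hΨs, hpt, hflat, ?_⟩
  have hd := hΨ1.contDiffAt (Ψ.open_source.mem_nhds hq)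
  obtain ⟨K, W, hW, hK⟩ := hd.exists_lipschitzOnWith
  have hUq : Ψ ⁻¹' U ∈ 𝓝 (Ψ.symm p) :=
    hd.continuousAt (by rw [Ψ.right_inv hpt]; exact hU.mem_nhds hpU)
  -- In the interior of `W` the Lipschitz constant `K` also bounds the derivative; hence the two
  -- factors `K`.
  refine ⟨(interior W ∩ Ψ.source) ∩ Ψ ⁻¹' U, Filter.inter_mem
    (Filter.inter_mem (interior_mem_nhds.2 hW) (Ψ.open_source.mem_nhds hq)) hUq, L * K * K, ?_⟩
  rintro a ⟨⟨haW, has⟩, haU⟩ c ⟨⟨hcW, hcs⟩, hcU⟩ w n ha0 hc0 hw0 hn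
  have hmem : ∀ w' : EuclideanSpace ℝ (Fin d), (∀ i : Fin d, m ≤ (i : ℕ) → w' i = 0) →
      fderiv ℝ Ψ c w' ∈ tangentSet M (Ψ c) := fun w' hw' =>
    fderiv_mem_tangentSet Ψ.open_source hΨ1 (fun y hy h0 => (hflat y hy).2 h0) hcs hc0 hw'
  have hΨca : ‖Ψ c - Ψ a‖ ≤ K * ‖c - a‖ := by
    simpa [dist_eq_norm] using
      hK.dist_le_mul c (interior_subset hcW) a (interior_subset haW)
  have hfd : ‖fderiv ℝ Ψ c w‖ ≤ K * ‖w‖ :=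
    ContinuousLinearMap.le_of_opNorm_le _
      (norm_fderiv_le_of_lipschitzOn ℝ (mem_interior_iff_mem_nhds.1 hcW) hK) w
  have hT : inner ℝ n (fderiv ℝ Ψ c w) ≤ ‖fderiv ℝ Ψ c w‖ * (‖n‖ * (L * ‖Ψ c - Ψ a‖)) := by
    rcases eq_or_ne (fderiv ℝ Ψ c w) 0 with h0 | h0
    · simp [h0]
    set z := fderiv ℝ Ψ c w with hz
    have hzpos : 0 < ‖z‖ := norm_pos_iff.2 h0
    have hunit : ‖z‖⁻¹ • z ∈ tangentSet M (Ψ c) ∩ Metric.sphere 0 1 := by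
      refine ⟨?_, by simp [norm_smul, hzpos.ne']⟩
      rw [hz, ← map_smul]
      exact hmem _ fun i hi => by simp [hw0 i hi]
    have := inner_le_of_sphereHausdorffDist_le (by positivity)
      (hLip (Ψ c) ⟨(hflat c hcs).2 hc0, hcU⟩ (Ψ a) ⟨(hflat a has).2 ha0, haU⟩) hunit hn
    rw [inner_smul_right, inv_mul_le_iff₀ hzpos] at this
    exact this
  calc inner ℝ n (fderiv ℝ Ψ c w) ≤ ‖fderiv ℝ Ψ c w‖ * (‖n‖ * (L * ‖Ψ c - Ψ a‖)) := hT
    _ ≤ (K * ‖w‖) * (‖n‖ * (L * (K * ‖c - a‖))) := by gcongr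
    _ = L * K * K * ‖n‖ * ‖c - a‖ * ‖w‖ := by ring

theorem mainTheorem7 {d m : ℕ} (hm : 1 ≤ m) (hmd : m < d)
    (M : Set (EuclideanSpace ℝ (Fin d))) (hM : M.Nonempty) :
    (IsLipOneSubmanifold m M →
      reach M ≤ sInf (frontierFunction M '' unitNormalBundle M) ∧
      (IsClosed M → reach M = sInf (frontierFunction M '' unitNormalBundle M)) ∧
      (IsCompact M →
        IsLeast (frontierFunction M '' unitNormalBundle M) (reach M) ∧ 0 < reach M)) ∧
    (IsCkSubmanifold 2 m M → IsCompact M → 0 < reach M) := by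
  have hlb : reach M ∈ lowerBounds (frontierFunction M '' unitNormalBundle M) := by
    rintro _ ⟨q, hq, rfl⟩
    exact reach_le_frontierFunction hq
  refine ⟨fun h => ⟨le_sInf hlb, fun hMc => ?_, fun hMc => ?_⟩, fun h hMc => ?_⟩
  · exact (le_sInf hlb).antisymm (sInf_frontierFunction_le_reach hM hMc)
  · have hpos := h.hasLocalQuadraticNormalBound.reach_pos hM hMc
    exact ⟨⟨reach_mem_image_frontierFunction (by omega) hM hMc hpos, hlb⟩, hpos⟩
  · exact h.hasLocalQuadraticNormalBound.reach_pos hM hMc
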